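/- Let $K$ be $\mathbb R$ or $\mathbb C$, let $m\ge 2$ be an integer, $m=d_1+\cdots+d_k$ with integers $d_i\ge 1$, and let $W_1,\dots,W_k$ be $2$-dimensional vector spaces over $K$ with duals $W_i^*$. Write $S^{d}W_i^*\subset (W_i^*)^{\otimes d}$ for the subspace of symmetric tensors (those fixed by all permutations of the $d$ slots). For each $j\in\{1,\dots,k\}$ let $$\mathrm{ins}_j:(W_j^*)^{\otimes d_j}\otimes\bigotimes_{i\ne j}(W_i^*)^{\otimes d_i}\to\bigotimes_{i=1}^k(W_i^*)^{\otimes d_i}$$ be the canonical isomorphism that inserts the first factor in the $j$-th place, and let $\Gamma_j\subset\bigotimes_{i\ne j}(W_i^*)^{\otimes d_i}$ be a $1$-dimensional subspace. Suppose that $\Gamma_1,\dots,\Gamma_k$ define a standard Segre–Veronese factorization structure, that is, the subspace $$\sum_{j=1}^k \mathrm{ins}_j\bigl(S^{d_j}W_j^*\otimes\Gamma_j\bigr)\subset\bigotimes_{i=1}^k(W_i^*)^{\otimes d_i}$$ has dimension $m+1$ (the factorization structure is then the inclusion of this subspace). Then for every $j\in\{1,\dots,k\}$: 1. $\Gamma_j\subset\bigotimes_{i\ne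 j}S^{d_i}W_i^*$. 2. If $\Gamma_j$ is decomposable, $\Gamma_j=\bigotimes_{r\ne j}\bigotimes_{p=1}^{d_r}a_j^{r,p}$ with $1$-dimensional subspaces $a_j^{r,p}\subset W_r^*$, then $a_j^{r,1}=\cdots=a_j^{r,d_r}=:a_j^r$ for every $r\neq j$, and hence $\Gamma_j=\bigotimes_{r\ne j}(a_j^r)^{\otimes d_r}$. -/

import Mathlib

open scoped TensorProduct

namespace SegreVeronese

universe u v w

section Tensors

variable (K : Type u) [Field K]

/-- The subspace `S^n U` of symmetric tensors in the tensor power `U^{⊗ n}`: the tensors that are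
fixed by every permutation of the `n` slots. -/
def symTensors (n : ℕ) (U : Type v) [AddCommGroup U] [Module K U] :
    Submodule K (⨂[K]^n U) where
  carrier := {t | ∀ σ : Equiv.Perm (Fin n),
    PiTensorProduct.reindex K (fun _ : Fin n => U) σ t = t}
  add_mem' {s t} hs ht σ := (map_add _ s t).trans (congrArg₂ (· + ·) (hs σ) (ht σ))
  zero_mem' _ := map_zero _
  smul_mem' c t ht σ := (map_smul _ c t).trans (congrArg (c • ·) (ht σ))

/-- The tensor product `⨂ i, P i` of subspaces `P i ⊆ E i`, viewed as a subspace of `⨂ i, E i`. -/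
def tensorSubspace {κ : Type w} {E : κ → Type v} [∀ i, AddCommGroup (E i)] [∀ i, Module K (E i)]
    (P : ∀ i, Submodule K (E i)) : Submodule K (⨂[K] i, E i) :=
  LinearMap.range (PiTensorProduct.mapIncl P)

/-- The canonical isomorphism `E j ⊗ ⨂_{i ≠ j} E i ≃ ⨂_i E i` that inserts the first factor in
the `j`-th place (see `ins_tmul_tprod` for its value on decomposable tensors). -/
noncomputable def ins {ι : Type w} [DecidableEq ι] (E : ι → Type v)
    [∀ i, AddCommGroup (E i)] [∀ i, Module K (E i)] (j : ι) :
    (E j ⊗[K] (⨂[K] i : {i : ι // i ≠ j}, E i)) ≃ₗ[K] ⨂[K] i, E i :=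
  (TensorProduct.congr
      (PiTensorProduct.subsingletonEquiv (R := K) (s := fun i : {i : ι // i = j} => E i)
        ⟨j, rfl⟩).symm
      (LinearEquiv.refl K _)).trans
    ((PiTensorProduct.tmulEquivDep K
        (fun i : {i : ι // i = j} ⊕ {i : ι // i ≠ j} => E (Equiv.sumCompl (· = j) i))).trans
      (PiTensorProduct.reindex K E (Equiv.sumCompl (· = j)).symm).symm)

/-- The subspace `S^n U` contains the decomposable symmetric tensors. -/
theorem tprod_const_mem_symTensors (n : ℕ) {U : Type v} [AddCommGroup U] [Module K U] (u : U) :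
    PiTensorProduct.tprod K (fun _ : Fin n => u) ∈ symTensors K n U := by
  intro σ
  exact PiTensorProduct.reindex_tprod σ (fun _ : Fin n => u)

/-- On decomposable tensors, `ins` puts `x (j)` back in the `j`-th place. -/
theorem ins_tmul_tprod {ι : Type w} [DecidableEq ι] (E : ι → Type v)
    [∀ i, AddCommGroup (E i)] [∀ i, Module K (E i)] (j : ι) (x : ∀ i, E i) :
    ins K E j (x j ⊗ₜ[K] PiTensorProduct.tprod K fun i : {i : ι // i ≠ j} => x i) =
      PiTensorProduct.tprod K x := by
  have h : (PiTensorProduct.subsingletonEquiv (R := K) (s := fun i : {i : ι // i = j} => E i)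
        ⟨j, rfl⟩).symm (x j) = PiTensorProduct.tprod K fun i : {i : ι // i = j} => x i := by
    rw [LinearEquiv.symm_apply_eq, PiTensorProduct.subsingletonEquiv_apply_tprod]
  let N : {i : ι // i = j} ⊕ {i : ι // i ≠ j} → Type v :=
    fun i => E (Equiv.sumCompl (· = j) i)
  let e := (PiTensorProduct.reindex K E (Equiv.sumCompl (· = j)).symm).symm
  change e (PiTensorProduct.tmulEquivDep K N
    ((PiTensorProduct.subsingletonEquiv (R := K) (s := fun i : {i : ι // i = j} => E i)
      ⟨j, rfl⟩).symm (x j) ⊗ₜ[K] PiTensorProduct.tprod K fun i : {i : ι // i ≠ j} => x i)) = _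
  rw [h]
  refine (congrArg e (PiTensorProduct.tmulEquivDep_apply (R := K) (N := N)
    (fun i => x i) (fun i => x i))).trans ?_
  refine (LinearEquiv.symm_apply_eq _).2 ?_
  refine Eq.trans ?_ (PiTensorProduct.reindex_tprod (R := K) (s := E)
    (Equiv.sumCompl (· = j)).symm x).symm
  refine congrArg (PiTensorProduct.tprod K) ?_
  funext i
  rcases i with i | i <;> rfl

end Tensors

section Structures

variable (K : Type u) [RCLike K] {ι : Type w} [DecidableEq ι]

/-- The space `(W_i^*)^{⊗ d_i}` of tensors in the grouped `i`-slots. -/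
abbrev GroupedTensors (d : ι → ℕ) (W : ι → Type v) [∀ i, AddCommGroup (W i)] [∀ i, Module K (W i)]
    (i : ι) : Type (max u v) :=
  ⨂[K]^(d i) (Module.Dual K (W i))

variable (d : ι → ℕ) (W : ι → Type v) [∀ i, AddCommGroup (W i)] [∀ i, Module K (W i)]

/-- The subspace `∑_j ins_j (S^{d_j} W_j^* ⊗ Γ_j)` of `⨂_i (W_i^*)^{⊗ d_i}`. -/
noncomputable def image (Γ : ∀ j : ι, Submodule K (⨂[K] i : {i : ι // i ≠ j}, GroupedTensors K d W i)) :
    Submodule K (⨂[K] i, GroupedTensors K d W i) :=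
  ⨆ j : ι, Submodule.map (ins K (GroupedTensors K d W) j).toLinearMap
    (Submodule.map₂ (TensorProduct.mk K (GroupedTensors K d W j) (⨂[K] i : {i : ι // i ≠ j}, GroupedTensors K d W i))
      (symTensors K (d j) (Module.Dual K (W j))) (Γ j))

/-- The subspaces `Γ_j` define a standard Segre-Veronese factorization structure for the partition
`m = ∑ i, d_i`, namely the inclusion of `image K d W Γ` in `⨂_i (W_i^*)^{⊗ d_i}`. -/
structure IsStandard [Fintype ι] (m : ℕ)
    (Γ : ∀ j : ι, Submodule K (⨂[K] i : {i : ι // i ≠ j}, GroupedTensors K d W i)) : Prop where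
  two_le : 2 ≤ m
  sum_eq : ∑ i, d i = m
  one_le : ∀ i, 1 ≤ d i
  finrank_space : ∀ i, Module.finrank K (W i) = 2
  finrank_defining : ∀ j, Module.finrank K (Γ j) = 1
  finrank_image : Module.finrank K (image K d W Γ) = m + 1

end Structures

end SegreVeronese

/-!
Write `V_j` for the subspace `ins_j (S_j ⊗ Γ_j)`, with `S_j` the symmetric tensors of the `j`-th
group and `Γ_j = K ∙ γ_j`. Since `dim V_j = dim S_j ≥ d_j + 1`, a sum of the `V_j` of dimension only
`m + 1` forces a space of linear relations `∑_j ins_j (x_j ⊗ γ_j) = 0`, `x_j ∈ S_j`, of dimension at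
least `k - 1`.

This is the largest possible dimension: for *any* nonzero `γ_j`, `j ∈ J`, the relations indexed by a
nonempty finite set `J` have dimension at most `|J| - 1` (`finrank_relations_lt_card`), by induction
on `J`, contracting one slot with a generic functional.

If some `γ_j` is not in `S_i` in the slot `i ≠ j`, contract the slot `i` with a functional that
vanishes on `S_i` but does not annihilate `γ_j`. The `i`-th terms of all relations disappear, so the
relations split into those indexed by the set `J ∌ i` of the surviving `γ_j` and those indexed by
its complement. Both sets are nonempty, and the bound applied to each leaves dimension at most
`(|J| - 1) + (k - |J| - 1) = k - 2`, a contradiction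
(`mem_tensorSubspace_of_card_le_finrank`). Being in `S_i` in each slot is the same as
being in `⨂ S_i` (`mem_tensorSubspace_of_slotMap_eq`), which is the first claim.

The second claim follows because a transposition within a group fixes the decomposable line `Γ_j`,
and pure tensors determine their factors up to scalars (`eq_of_tensorSubspace_le_symTensors`).

To stay in one tensor product throughout, contraction of a slot with `φ` is encoded as the rank-one
endomorphism `x ↦ φ x • e` of that slot, for a fixed vector `e ≠ 0`.
-/

open scoped TensorProduct
open Function Module

namespace SegreVeronese

/-! ### Endomorphisms of a single slot -/

section OneSlot

variable {K : Type*} [Field K] {κ : Type*} [DecidableEq κ] {E : κ → Type*}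
  [∀ i, AddCommGroup (E i)] [∀ i, Module K (E i)]

/-- The endomorphism of `⨂ i, E i` that applies `q` in the slot `i` and the identity in all other
slots, as a linear function of `q`. -/
noncomputable def slotMap (i : κ) : (E i →ₗ[K] E i) →ₗ[K] (⨂[K] l, E l) →ₗ[K] ⨂[K] l, E l :=
  (PiTensorProduct.mapMultilinear K E E).toLinearMap (fun _ => LinearMap.id) i

theorem slotMap_apply (i : κ) (q : E i →ₗ[K] E i) :
    slotMap i q = PiTensorProduct.map (update (fun _ => LinearMap.id) i q) := rfl

theorem slotMap_comp (i : κ) (p q : E i →ₗ[K] E i) :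
    slotMap (E := E) i (p ∘ₗ q) = slotMap i p ∘ₗ slotMap i q := by
  simp only [slotMap_apply, ← PiTensorProduct.map_comp]
  congr 1
  funext l
  rcases eq_or_ne l i with rfl | h
  · simp
  · simp [h]

theorem slotMap_id (i : κ) : slotMap (E := E) i (LinearMap.id : E i →ₗ[K] E i) = LinearMap.id := by
  rw [slotMap_apply, update_eq_self i (fun l => (LinearMap.id : E l →ₗ[K] E l)),
    PiTensorProduct.map_id]

/-- A one-slot endomorphism that does not kill `γ` can be replaced by one of rank one with any
prescribed image `K ∙ e`: on the slot, write `q = ∑ b, (b^* ∘ q) ⊗ b` in a basis. -/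
theorem exists_dual_slotMap_ne_zero (i : κ) [FiniteDimensional K (E i)] {e : E i} (he : e ≠ 0)
    {q : E i →ₗ[K] E i} {γ : ⨂[K] l, E l} (h : slotMap i q γ ≠ 0) :
    ∃ φ : Dual K (E i), slotMap i ((φ ∘ₗ q).smulRight e) γ ≠ 0 := by
  by_contra! H
  apply h
  let b := finBasis K (E i)
  have hq : q = ∑ s, (b.coord s ∘ₗ q).smulRight (b s) := by
    ext x
    simp [LinearMap.sum_apply, b.sum_repr]
  rw [hq, map_sum, LinearMap.sum_apply]
  refine Finset.sum_eq_zero fun s _ => ?_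
  obtain ⟨ψ, hψ⟩ := Module.Projective.exists_dual_eq_one K he
  have hcomp : (b.coord s ∘ₗ q).smulRight (b s) =
      ψ.smulRight (b s) ∘ₗ (b.coord s ∘ₗ q).smulRight e := by
    ext x
    simp [hψ]
  rw [hcomp, slotMap_comp, LinearMap.comp_apply, H, map_zero]

/-- A tensor fixed in each slot by a projection onto `P i` lies in `⨂ i, P i`. -/
theorem mem_tensorSubspace_of_slotMap_eq [Fintype κ] (P : ∀ i, Submodule K (E i))
    (p : ∀ i, E i →ₗ[K] P i) {γ : ⨂[K] l, E l}
    (h : ∀ i, slotMap i ((P i).subtype ∘ₗ p i) γ = γ) : γ ∈ tensorSubspace K P := by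
  have key : ∀ s : Finset κ,
      PiTensorProduct.map (fun i => if i ∈ s then (P i).subtype ∘ₗ p i else LinearMap.id) γ = γ := by
    intro s
    induction s using Finset.induction_on with
    | empty => simp
    | insert i s his ih =>
      have hc : PiTensorProduct.map (fun l => if l ∈ insert i s then (P l).subtype ∘ₗ p l
            else LinearMap.id) =
          slotMap i ((P i).subtype ∘ₗ p i) ∘ₗ PiTensorProduct.map (fun l =>
            if l ∈ s then (P l).subtype ∘ₗ p l else LinearMap.id) := by
        rw [slotMap_apply, ← PiTensorProduct.map_comp]
        congr 1
        funext l
        rcases eq_or_ne l i with rfl | hl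
        · simp [his]
        · simp [hl]
      rw [hc, LinearMap.comp_apply, ih, h]
  refine ⟨PiTensorProduct.map p γ, ?_⟩
  have := key Finset.univ
  simp only [Finset.mem_univ, if_true, PiTensorProduct.map_comp] at this
  exact this

theorem slotMap_eq_of_mem_tensorSubspace {P : ∀ i, Submodule K (E i)} (i : κ)
    {q : E i →ₗ[K] E i} (hq : ∀ x ∈ P i, q x = x) {γ : ⨂[K] l, E l}
    (hγ : γ ∈ tensorSubspace K P) : slotMap i q γ = γ := by
  obtain ⟨t, rfl⟩ := hγ
  rw [slotMap_apply, PiTensorProduct.mapIncl, ← LinearMap.comp_apply, ← PiTensorProduct.map_comp]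
  congr 2
  funext l
  rcases eq_or_ne l i with rfl | hl
  · ext x
    simp [hq]
  · simp [hl]

end OneSlot

/-! ### Pure tensors -/

section PureTensors

variable {K : Type*} [Field K] {κ : Type*} [Finite κ] {E : κ → Type*}
  [∀ i, AddCommGroup (E i)] [∀ i, Module K (E i)]

/-- Pure tensors determine their factors up to scalars. -/
theorem mem_span_of_tprod_eq_smul {x y : ∀ i, E i} (hx : ∀ i, x i ≠ 0) {c : K}
    (h : PiTensorProduct.tprod K x = c • PiTensorProduct.tprod K y) (i : κ) :
    x i ∈ K ∙ y i := by
  classical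
  cases nonempty_fintype κ
  by_contra hi
  obtain ⟨φ, hφx, hφ⟩ := Submodule.exists_le_ker_of_notMem hi
  have hφy : φ (y i) = 0 := hφ (Submodule.mem_span_singleton_self _)
  choose ψ hψ using fun l => Module.Projective.exists_dual_eq_one K (hx l)
  have := congrArg (PiTensorProduct.lift
    ((MultilinearMap.mkPiRing K κ (1 : K)).compLinearMap (update ψ i φ))) h
  simp only [map_smul, PiTensorProduct.lift.tprod, MultilinearMap.compLinearMap_apply,
    MultilinearMap.mkPiRing_apply] at this
  have hy : ∏ l, update ψ i φ l (y l) = 0 :=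
    Finset.prod_eq_zero (Finset.mem_univ i) (by simpa using hφy)
  simp only [hy, smul_eq_mul, mul_one, mul_zero, Finset.prod_eq_zero_iff, Finset.mem_univ,
    true_and] at this
  obtain ⟨l, hl⟩ := this
  rcases eq_or_ne l i with rfl | hli
  · exact hφx (by simpa using hl)
  · simp [hli, hψ] at hl

theorem tprod_ne_zero {x : ∀ i, E i} (hx : ∀ i, x i ≠ 0) : PiTensorProduct.tprod K x ≠ 0 := by
  classical
  cases nonempty_fintype κ
  intro h
  choose ψ hψ using fun l => Module.Projective.exists_dual_eq_one K (hx l)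
  have := congrArg (PiTensorProduct.lift
    ((MultilinearMap.mkPiRing K κ (1 : K)).compLinearMap ψ)) h
  simp [hψ] at this

end PureTensors

/-! ### Dimension of the symmetric tensors -/

section SymmetricTensors

variable {K : Type*} [Field K] [CharZero K] {U : Type*} [AddCommGroup U] [Module K U]

/-- The powers `(e + t • f)^{⊗ n}` for `n + 1` values of `t` are linearly independent: the
coefficient functionals `(e^*)^{⊗ (n - l)} ⊗ (f^*)^{⊗ l}` evaluate on them to a Vandermonde
matrix. -/
theorem succ_le_finrank_symTensors [FiniteDimensional K U] (hU : 2 ≤ finrank K U) (n : ℕ) :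
    n + 1 ≤ finrank K (symTensors K n U) := by
  let b := finBasis K U
  let i₀ : Fin (finrank K U) := ⟨0, by omega⟩
  let i₁ : Fin (finrank K U) := ⟨1, by omega⟩
  have h01 : i₀ ≠ i₁ := by simp [i₀, i₁]
  let v : Fin (n + 1) → symTensors K n U := fun s =>
    ⟨_, tprod_const_mem_symTensors K n (b i₀ + ((s : ℕ) : K) • b i₁)⟩
  suffices LinearIndependent K v by simpa using this.fintype_card_le_finrank
  let ev : Fin (n + 1) → Dual K (⨂[K]^n U) := fun l => PiTensorProduct.lift
    ((MultilinearMap.mkPiRing K (Fin n) (1 : K)).compLinearMap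
      (fun p => if p.castSucc < l then b.coord i₁ else b.coord i₀))
  have hev : ∀ l s, ev l (v s) = ((s : ℕ) : K) ^ (l : ℕ) := by
    intro l s
    have hfac : ∀ p : Fin n, (if p.castSucc < l then b.coord i₁ else b.coord i₀)
        (b i₀ + ((s : ℕ) : K) • b i₁) = if p.castSucc < l then ((s : ℕ) : K) else 1 := by
      intro p
      split_ifs <;> simp [h01, h01.symm]
    simp only [ev, v, PiTensorProduct.lift.tprod, MultilinearMap.compLinearMap_apply,
      MultilinearMap.mkPiRing_apply, hfac, Finset.prod_ite, Finset.prod_const, one_pow, mul_one,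
      smul_eq_mul]
    congr 1
    have : (Finset.univ.filter fun p : Fin n => p.castSucc < l).map Fin.castSuccEmb =
        Finset.Iio l := by
      ext p
      simp only [Finset.mem_map, Finset.mem_filter, Finset.mem_univ, true_and, Finset.mem_Iio,
        Fin.coe_castSuccEmb]
      refine ⟨by rintro ⟨q, hq, rfl⟩; exact hq, fun hp => ⟨⟨p, by omega⟩, hp, rfl⟩⟩
    rw [← Finset.card_map, this, Fin.card_Iio]
  rw [Fintype.linearIndependent_iff]
  intro g hg
  have hdet : (Matrix.vandermonde fun s : Fin (n + 1) => ((s : ℕ) : K)).det ≠ 0 :=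
    Matrix.det_vandermonde_ne_zero_iff.2 fun s t h => Fin.ext (Nat.cast_injective h)
  refine congrFun (Matrix.eq_zero_of_vecMul_eq_zero hdet (v := g) ?_)
  funext l
  have := congrArg (fun t : symTensors K n U => ev l t) hg
  simpa [Matrix.vecMul, dotProduct, hev] using this

end SymmetricTensors

/-! ### Linear relations between the subspaces `ins_j (E_j ⊗ γ_j)` -/

section Relations

variable {K : Type*} [Field K] {ι : Type*} [DecidableEq ι] {E : ι → Type*}
  [∀ i, AddCommGroup (E i)] [∀ i, Module K (E i)]

theorem map_ins (f : ∀ i, E i →ₗ[K] E i) (j : ι) (x : E j)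
    (γ : ⨂[K] i : {i : ι // i ≠ j}, E i) :
    PiTensorProduct.map f (ins K E j (x ⊗ₜ γ)) =
      ins K E j (f j x ⊗ₜ PiTensorProduct.map (fun i : {i : ι // i ≠ j} => f i) γ) := by
  induction γ using PiTensorProduct.induction_on with
  | smul_tprod r y =>
    let z : ∀ i, E i := fun i => if h : i = j then h ▸ x else y ⟨i, h⟩
    have hzj : z j = x := by simp [z]
    have hz : (fun i : {i : ι // i ≠ j} => z i) = y := by
      funext i
      simp [z, i.2]
    have h1 := ins_tmul_tprod K E j z
    have h2 := ins_tmul_tprod K E j (fun i => f i (z i))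
    rw [hzj, hz] at h1
    rw [hzj] at h2
    have hy : PiTensorProduct.map (fun i : {i : ι // i ≠ j} => f i) (PiTensorProduct.tprod K y) =
        PiTensorProduct.tprod K fun i : {i : ι // i ≠ j} => f i (z i) := by
      rw [PiTensorProduct.map_tprod, ← hz]
    simp only [TensorProduct.tmul_smul, map_smul, h1, hy, h2, PiTensorProduct.map_tprod]
  | add a b ha hb => simp only [TensorProduct.tmul_add, map_add, ha, hb]

theorem slotMap_ins_self (j : ι) (q : E j →ₗ[K] E j) (x : E j)
    (γ : ⨂[K] i : {i : ι // i ≠ j}, E i) :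
    slotMap j q (ins K E j (x ⊗ₜ γ)) = ins K E j (q x ⊗ₜ γ) := by
  have h : (fun i : {i : ι // i ≠ j} =>
      update (fun i => (LinearMap.id : E i →ₗ[K] E i)) j q i) = fun _ => LinearMap.id := by
    funext i
    simp [i.2]
  rw [slotMap_apply, map_ins, update_self, h, PiTensorProduct.map_id, LinearMap.id_apply]

theorem slotMap_ins_of_ne {i j : ι} (hij : i ≠ j) (q : E i →ₗ[K] E i) (x : E j)
    (γ : ⨂[K] i : {i : ι // i ≠ j}, E i) :
    slotMap i q (ins K E j (x ⊗ₜ γ)) =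
      ins K E j (x ⊗ₜ slotMap (E := fun l : {l : ι // l ≠ j} => E l) ⟨i, hij⟩ q γ) := by
  rw [slotMap_apply, map_ins, update_of_ne hij.symm, LinearMap.id_apply, slotMap_apply]
  congr 4
  exact update_comp_eq_of_injective' (fun l => (LinearMap.id : E l →ₗ[K] E l))
    Subtype.val_injective ⟨i, hij⟩ q

theorem eq_zero_of_ins_tmul_eq_zero {j : ι} {x : E j} {γ : ⨂[K] i : {i : ι // i ≠ j}, E i}
    (hγ : γ ≠ 0) (h : ins K E j (x ⊗ₜ γ) = 0) : x = 0 := by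
  obtain ⟨ψ, hψ⟩ := Module.Projective.exists_dual_eq_one K hγ
  rw [LinearEquiv.map_eq_zero_iff] at h
  simpa [hψ] using congrArg (TensorProduct.rid K (E j) ∘ LinearMap.lTensor (E j) ψ) h

variable [Fintype ι]

/-- The map `(x_j)_j ↦ ∑_j ins_j (x_j ⊗ γ_j)`; its kernel consists of the linear relations between
the subspaces `ins_j (E_j ⊗ γ_j)`. -/
noncomputable def insSum (γ : ∀ j : ι, ⨂[K] i : {i : ι // i ≠ j}, E i) :
    (∀ i, E i) →ₗ[K] ⨂[K] i, E i :=
  ∑ j, (ins K E j).toLinearMap ∘ₗ (TensorProduct.mk K _ _).flip (γ j) ∘ₗ LinearMap.proj j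

theorem insSum_apply (γ : ∀ j : ι, ⨂[K] i : {i : ι // i ≠ j}, E i) (x : ∀ i, E i) :
    insSum γ x = ∑ j, ins K E j (x j ⊗ₜ γ j) := by
  simp [insSum, LinearMap.sum_apply]

/-- The family obtained from `γ` by applying `q` in the slot `i` of every `γ j` with `j ≠ i`. As
`γ i` has no slot `i`, the `i`-th member is set to `0`. -/
noncomputable def slotFamily (i : ι) (q : E i →ₗ[K] E i)
    (γ : ∀ j : ι, ⨂[K] i : {i : ι // i ≠ j}, E i) (j : ι) : ⨂[K] i : {i : ι // i ≠ j}, E i :=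
  if h : i ≠ j then slotMap (E := fun l : {l : ι // l ≠ j} => E l) ⟨i, h⟩ q (γ j) else 0

/-- Applying `q` in the slot `i` turns a relation whose `i`-th entry is killed by `q` into a
relation for the family `slotFamily i q γ`. -/
theorem insSum_slotFamily {i : ι} {q : E i →ₗ[K] E i}
    {γ : ∀ j : ι, ⨂[K] i : {i : ι // i ≠ j}, E i} {x : ∀ i, E i} (hx : q (x i) = 0) :
    insSum (slotFamily i q γ) x = slotMap i q (insSum γ x) := by
  rw [insSum_apply, insSum_apply, map_sum]
  refine Finset.sum_congr rfl fun j _ => ?_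
  rcases eq_or_ne i j with rfl | hij
  · simp [slotFamily, slotMap_ins_self, hx]
  · simp [slotFamily, hij, slotMap_ins_of_ne hij]

theorem insSum_congr {γ γ' : ∀ j : ι, ⨂[K] i : {i : ι // i ≠ j}, E i} {x x' : ∀ i, E i}
    (h : ∀ j, x j ⊗ₜ[K] γ j = x' j ⊗ₜ[K] γ' j) : insSum γ x = insSum γ' x' := by
  simp only [insSum_apply, h]

/-- The relations between subspaces `ins_j (E_j ⊗ γ_j)`, `j ∈ J`, with `γ_j ≠ 0` form a space of
dimension less than `|J|`. By induction on `J`: for `j ∈ J`, contract the slot `j` with a functional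
`φ` that annihilates no other `γ_i`. On the hyperplane `φ (x_j) = 0` of the space of
relations this gives relations indexed by `J \ {j}`, and `x_j` can be recovered from the other
entries. -/
theorem finrank_relations_lt_card [Infinite K] [∀ i, FiniteDimensional K (E i)]
    [∀ i, Nontrivial (E i)] (J : Finset ι) (hJ : J.Nonempty) :
    ∀ (γ : ∀ j : ι, ⨂[K] i : {i : ι // i ≠ j}, E i) (_ : ∀ j ∈ J, γ j ≠ 0)
      (R : Submodule K (∀ i, E i)) (_ : ∀ x ∈ R, ∀ j ∉ J, x j = 0)
      (_ : ∀ x ∈ R, insSum γ x = 0), finrank K R < J.card := by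
  induction hJ using Finset.Nonempty.cons_induction with
  | singleton j =>
    intro γ hγ R hsupp hR
    suffices R = ⊥ by simp [this]
    refine (Submodule.eq_bot_iff R).2 fun x hx => ?_
    have h0 : ∀ i, i ≠ j → x i = 0 := fun i hi => hsupp x hx i (by simpa using hi)
    have h := hR x hx
    rw [insSum_apply, Finset.sum_eq_single j (fun i _ hi => by simp [h0 i hi]) (by simp)] at h
    funext i
    rcases eq_or_ne i j with rfl | hi
    · exact eq_zero_of_ins_tmul_eq_zero (hγ i (by simp)) h
    · exact h0 i hi
  | cons j J hj hJ ih =>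
    intro γ hγ R hsupp hR
    have hne : ∀ i ∈ J, j ≠ i := by
      rintro i hi rfl
      exact hj hi
    obtain ⟨e, he⟩ := exists_ne (0 : E j)
    obtain ⟨φ, hφ⟩ : ∃ φ : Dual K (E j), ∀ i : J, slotFamily j (φ.smulRight e) γ i ≠ 0 := by
      let L : ∀ i : J, Dual K (E j) →ₗ[K] ⨂[K] l : {l : ι // l ≠ (i : ι)}, E l := fun i =>
        (slotMap (E := fun l : {l : ι // l ≠ (i : ι)} => E l) ⟨j, hne i i.2⟩).flip (γ i) ∘ₗ
          (LinearMap.smulRightₗ (R := K) (M₂ := E j) (M := E j)).flip e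
      have hL : ∀ i, LinearMap.ker (L i) ≠ ⊤ := by
        intro i h
        obtain ⟨φ, hφ⟩ := exists_dual_slotMap_ne_zero
          (E := fun l : {l : ι // l ≠ (i : ι)} => E l) ⟨j, hne i i.2⟩ he
          (q := LinearMap.id) (γ := γ i)
          (by rw [slotMap_id]; exact hγ i (by simp))
        exact hφ (LinearMap.congr_fun (LinearMap.ker_eq_top.1 h) φ)
      obtain ⟨φ, hφ⟩ := Submodule.exists_forall_notMem_of_forall_ne_top _ hL
      refine ⟨φ, fun i h => hφ i ?_⟩
      rw [slotFamily, dif_pos (hne i i.2)] at h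
      exact h
    -- The map `ρ` that forgets the entry `x_j`, to be applied on the hyperplane `φ (x_j) = 0`.
    let ρ : R →ₗ[K] (∀ i, E i) :=
      (LinearMap.pi fun i => if i = j then 0 else LinearMap.proj i) ∘ₗ R.subtype
    have hρ : ∀ (x : R) i, ρ x i = if i = j then 0 else (x : ∀ i, E i) i := by
      intro x i
      by_cases h : i = j <;> simp [ρ, h]
    have hinj : Injective ρ := by
      refine (injective_iff_map_eq_zero ρ).2 fun x hx => ?_
      have h0 : ∀ i, i ≠ j → (x : ∀ i, E i) i = 0 := fun i hi => by
        have := congrFun hx i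
        rwa [hρ, if_neg hi] at this
      have h := hR x x.2
      rw [insSum_apply, Finset.sum_eq_single j (fun i _ hi => by simp [h0 i hi]) (by simp)] at h
      refine Subtype.ext (funext fun i => ?_)
      rcases eq_or_ne i j with rfl | hi
      · exact eq_zero_of_ins_tmul_eq_zero (hγ i (by simp)) h
      · exact h0 i hi
    let f : R →ₗ[K] K := (φ ∘ₗ LinearMap.proj j) ∘ₗ R.subtype
    have hlt : finrank K ((LinearMap.ker f).map ρ) < J.card := by
      refine ih (slotFamily j (φ.smulRight e) γ) (fun i hi => hφ ⟨i, hi⟩) _ ?_ ?_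
      · rintro _ ⟨x, -, rfl⟩ i hi
        rw [hρ]
        split_ifs with h
        · rfl
        · exact hsupp x x.2 i (by simp [h, hi])
      · rintro _ ⟨x, hxf, rfl⟩
        have hx : (φ.smulRight e) ((x : ∀ i, E i) j) = 0 := by
          have : φ ((x : ∀ i, E i) j) = 0 := hxf
          simp [this]
        rw [insSum_congr (γ' := slotFamily j (φ.smulRight e) γ) (x' := (x : ∀ i, E i)),
          insSum_slotFamily hx, hR x x.2, map_zero]
        intro i
        rw [hρ]
        split_ifs with h
        · subst h
          simp [slotFamily]
        · rfl
    have h0 : finrank K ((LinearMap.ker f).map ρ) = finrank K (LinearMap.ker f) :=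
      (Submodule.equivMapOfInjective ρ hinj _).finrank_eq.symm
    have h1 := f.finrank_range_add_finrank_ker
    have h2 := Submodule.finrank_le (LinearMap.range f)
    rw [finrank_self] at h2
    rw [Finset.card_cons]
    omega

/-- If the relations with entries in subspaces `S_j` reach the largest possible dimension, then
every `γ_j` lies in the tensor product of the other `S_i`. Otherwise contracting some slot `i` with
a functional that vanishes on `S_i` leaves a nonempty set `J ∌ i` of nonzero contractions. The
entries in `J` of the relations then satisfy relations between these contractions, and the
relations supported off `J` are relations of the `γ_j` with `j ∉ J`; together these have dimension
at most `(|J| - 1) + (|ι| - |J| - 1)`. -/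
theorem mem_tensorSubspace_of_card_le_finrank [Infinite K] [∀ i, FiniteDimensional K (E i)]
    [∀ i, Nontrivial (E i)] {γ : ∀ j : ι, ⨂[K] i : {i : ι // i ≠ j}, E i} (hγ : ∀ j, γ j ≠ 0)
    (S : ∀ i, Submodule K (E i)) (R : Submodule K (∀ i, E i)) (hRS : ∀ x ∈ R, ∀ i, x i ∈ S i)
    (hR : ∀ x ∈ R, insSum γ x = 0) (hcard : Fintype.card ι ≤ finrank K R + 1) (j : ι) :
    γ j ∈ tensorSubspace K (fun i : {i : ι // i ≠ j} => S i) := by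
  classical
  choose p hp using fun i =>
    (S i).subtype.exists_leftInverse_of_injective (S i).ker_subtype
  have hpS : ∀ i, ∀ x ∈ S i, (p i x : E i) = x := fun i x hx =>
    congrArg Subtype.val (LinearMap.congr_fun (hp i) ⟨x, hx⟩)
  refine mem_tensorSubspace_of_slotMap_eq _ (fun i : {i : ι // i ≠ j} => p i) ?_
  rintro ⟨i, hij⟩
  by_contra hne
  obtain ⟨e, he⟩ := exists_ne (0 : E i)
  obtain ⟨φ, hφ⟩ := exists_dual_slotMap_ne_zero
    (E := fun l : {l : ι // l ≠ j} => E l) ⟨i, hij⟩ he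
    (q := LinearMap.id - (S i).subtype ∘ₗ p i) (γ := γ j)
    (by
      rw [map_sub, slotMap_id, LinearMap.sub_apply, LinearMap.id_apply, sub_ne_zero]
      exact fun h => hne h.symm)
  let q : E i →ₗ[K] E i := (φ ∘ₗ (LinearMap.id - (S i).subtype ∘ₗ p i)).smulRight e
  have hq : ∀ x ∈ S i, q x = 0 := fun x hx => by simp [q, hpS i x hx]
  let J : Finset ι := Finset.univ.filter fun l => slotFamily i q γ l ≠ 0
  have hjJ : j ∈ J := by
    simp only [J, Finset.mem_filter, Finset.mem_univ, true_and]
    rw [slotFamily, dif_pos hij]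
    exact hφ
  have hiJ : i ∈ Jᶜ := by simp [J, slotFamily]
  -- The projection of relations to the entries in `J`.
  let ρ : R →ₗ[K] (∀ i, E i) :=
    (LinearMap.pi fun l => if l ∈ J then LinearMap.proj l else 0) ∘ₗ R.subtype
  have hρ : ∀ (x : R) l, ρ x l = if l ∈ J then (x : ∀ i, E i) l else 0 := by
    intro x l
    by_cases h : l ∈ J <;> simp [ρ, h]
  have h1 : finrank K (LinearMap.range ρ) < J.card := by
    refine finrank_relations_lt_card J ⟨j, hjJ⟩ (slotFamily i q γ)
      (fun l hl => (Finset.mem_filter.1 hl).2) _ ?_ ?_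
    · rintro _ ⟨x, rfl⟩ l hl
      rw [hρ, if_neg hl]
    · rintro _ ⟨x, rfl⟩
      rw [insSum_congr (γ' := slotFamily i q γ) (x' := (x : ∀ i, E i)),
        insSum_slotFamily (hq _ (hRS x x.2 i)), hR x x.2, map_zero]
      intro l
      rw [hρ]
      split_ifs with h
      · rfl
      · have : slotFamily i q γ l = 0 := by simpa [J] using h
        simp [this]
  have h2 : finrank K ((LinearMap.ker ρ).map R.subtype) < Jᶜ.card := by
    refine finrank_relations_lt_card Jᶜ ⟨i, hiJ⟩ γ (fun l _ => hγ l) _ ?_ ?_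
    · rintro _ ⟨x, hx, rfl⟩ l hl
      have := congrFun (LinearMap.mem_ker.1 hx) l
      rwa [hρ, if_pos (by simpa using hl)] at this
    · rintro _ ⟨x, -, rfl⟩
      exact hR x x.2
  rw [Submodule.finrank_map_subtype_eq] at h2
  have h3 := ρ.finrank_range_add_finrank_ker
  have h4 := Finset.card_add_card_compl J
  omega

end Relations

theorem exists_eq_span_singleton_of_finrank_eq_one {K V : Type*} [Field K] [AddCommGroup V]
    [Module K V] {L : Submodule K V} (h : finrank K L = 1) : ∃ v ≠ 0, L = K ∙ v := by
  obtain ⟨v, hv0, hv⟩ := finrank_eq_one_iff'.1 h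
  refine ⟨v, fun h => hv0 (Subtype.ext h), le_antisymm (fun x hx => ?_)
    ((Submodule.span_singleton_le_iff_mem _ _).2 v.2)⟩
  obtain ⟨c, hc⟩ := hv ⟨x, hx⟩
  exact Submodule.mem_span_singleton.2 ⟨c, congrArg Subtype.val hc⟩

/-! ### Standard structures have symmetric defining tensors -/

section StandardStructures

/-- If `dim S_j ≥ d_j + 1`, the `Γ_j` are lines and the sum of the subspaces `ins_j (S_j ⊗ Γ_j)` has
dimension at most `∑ j, d_j + 1`, then there is a space of relations of dimension at least
`|ι| - 1`, whence `Γ_j ≤ ⨂_{i ≠ j} S_i`. -/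
theorem le_tensorSubspace_of_finrank_iSup_le {K : Type*} [Field K] [Infinite K] {ι : Type*}
    [DecidableEq ι] [Fintype ι] {E : ι → Type*} [∀ i, AddCommGroup (E i)] [∀ i, Module K (E i)]
    [∀ i, FiniteDimensional K (E i)] {d : ι → ℕ} (S : ∀ i, Submodule K (E i))
    (hS : ∀ i, d i + 1 ≤ finrank K (S i))
    (Γ : ∀ j : ι, Submodule K (⨂[K] i : {i : ι // i ≠ j}, E i)) (hΓ : ∀ j, finrank K (Γ j) = 1)
    (h : finrank K (⨆ j : ι, Submodule.map (ins K E j).toLinearMap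
      (Submodule.map₂ (TensorProduct.mk K (E j) (⨂[K] i : {i : ι // i ≠ j}, E i)) (S j) (Γ j)) :
        Submodule K (⨂[K] i, E i)) ≤ ∑ i, d i + 1) (j : ι) :
    Γ j ≤ tensorSubspace K (fun i : {i : ι // i ≠ j} => S i) := by
  have hnt : ∀ i, Nontrivial (E i) := fun i => by
    have : Nontrivial (S i) := nontrivial_of_finrank_pos (R := K) (by have := hS i; omega)
    exact (Submodule.subtype_injective (S i)).nontrivial
  choose γ hγ0 hγ using fun j => exists_eq_span_singleton_of_finrank_eq_one (hΓ j)
  have hγΓ : ∀ j, γ j ∈ Γ j := fun j => hγ j ▸ Submodule.mem_span_singleton_self _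
  let incl : (∀ i, S i) →ₗ[K] (∀ i, E i) :=
    LinearMap.pi fun i => (S i).subtype ∘ₗ LinearMap.proj i
  have hincl : Injective incl := fun x y h => funext fun i => Subtype.ext (congrFun h i)
  let Φ := insSum γ ∘ₗ incl
  have h1 : finrank K (LinearMap.range Φ) ≤ ∑ i, d i + 1 := by
    refine (Submodule.finrank_mono ?_).trans h
    rintro _ ⟨x, rfl⟩
    rw [LinearMap.comp_apply, insSum_apply]
    exact Submodule.sum_mem _ fun i _ => Submodule.mem_iSup_of_mem i
      (Submodule.mem_map_of_mem (Submodule.apply_mem_map₂ _ (x i).2 (hγΓ i)))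
  have h2 : ∑ i, d i + Fintype.card ι ≤ finrank K (∀ i, S i) := by
    rw [finrank_pi_fintype, Fintype.card_eq_sum_ones, ← Finset.sum_add_distrib]
    exact Finset.sum_le_sum fun i _ => hS i
  have h3 := Φ.finrank_range_add_finrank_ker
  have h4 : finrank K ((LinearMap.ker Φ).map incl) = finrank K (LinearMap.ker Φ) :=
    (Submodule.equivMapOfInjective incl hincl _).finrank_eq.symm
  rw [hγ j, Submodule.span_singleton_le_iff_mem]
  refine mem_tensorSubspace_of_card_le_finrank hγ0 S ((LinearMap.ker Φ).map incl) ?_ ?_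
    (by omega) j
  · rintro _ ⟨x, -, rfl⟩ i
    exact (x i).2
  · rintro _ ⟨x, hx, rfl⟩
    exact hx

theorem le_tensorSubspace_symTensors_of_finrank_iSup_le {K : Type*} [Field K] [CharZero K]
    {ι : Type*} [DecidableEq ι] [Fintype ι] {d : ι → ℕ} {U : ι → Type*} [∀ i, AddCommGroup (U i)]
    [∀ i, Module K (U i)] [∀ i, FiniteDimensional K (U i)] (hU : ∀ i, 2 ≤ finrank K (U i))
    (Γ : ∀ j : ι, Submodule K (⨂[K] i : {i : ι // i ≠ j}, ⨂[K]^(d i) (U i)))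
    (hΓ : ∀ j, finrank K (Γ j) = 1)
    (h : finrank K (⨆ j : ι, Submodule.map (ins K (fun i => ⨂[K]^(d i) (U i)) j).toLinearMap
      (Submodule.map₂ (TensorProduct.mk K (⨂[K]^(d j) (U j))
        (⨂[K] i : {i : ι // i ≠ j}, ⨂[K]^(d i) (U i))) (symTensors K (d j) (U j)) (Γ j)) :
          Submodule K (⨂[K] i, ⨂[K]^(d i) (U i))) ≤ ∑ i, d i + 1) (j : ι) :
    Γ j ≤ tensorSubspace K (fun i : {i : ι // i ≠ j} => symTensors K (d i) (U i)) :=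
  le_tensorSubspace_of_finrank_iSup_le (fun i => symTensors K (d i) (U i))
    (fun i => succ_le_finrank_symTensors (hU i) _) Γ hΓ h j

theorem IsStandard.le_tensorSubspace {K : Type*} [RCLike K] {ι : Type*} [DecidableEq ι]
    [Fintype ι] {d : ι → ℕ} {W : ι → Type*} [∀ i, AddCommGroup (W i)] [∀ i, Module K (W i)] {m : ℕ}
    {Γ : ∀ j : ι, Submodule K (⨂[K] i : {i : ι // i ≠ j}, GroupedTensors K d W i)}
    (hΓ : IsStandard K d W m Γ) (j : ι) :
    Γ j ≤ tensorSubspace K (fun i : {i : ι // i ≠ j} =>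
      symTensors K (d i) (Module.Dual K (W i))) := by
  have hW : ∀ i, FiniteDimensional K (W i) := fun i =>
    FiniteDimensional.of_finrank_pos (by rw [hΓ.finrank_space]; norm_num)
  refine le_tensorSubspace_symTensors_of_finrank_iSup_le (U := fun i => Dual K (W i))
    (fun i => by rw [Subspace.dual_finrank_eq, hΓ.finrank_space]) Γ hΓ.finrank_defining ?_ j
  rw [hΓ.sum_eq]
  exact hΓ.finrank_image.le

end StandardStructures

/-! ### Decomposable lines of symmetric tensors -/

section Decomposable

variable {K : Type*} [Field K] {κ : Type*} [Finite κ] {n : κ → ℕ} {U : κ → Type*}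
  [∀ r, AddCommGroup (U r)] [∀ r, Module K (U r)]

/-- If a decomposable line consists of tensors that are symmetric in each group of slots, then its
factors within a group agree: a permutation of the group fixes the line, and pure tensors determine
their factors. -/
theorem eq_of_tensorSubspace_le_symTensors (a : (r : κ) → Fin (n r) → Submodule K (U r))
    (ha : ∀ r p, finrank K (a r p) = 1)
    (h : tensorSubspace K (fun r => tensorSubspace K (a r)) ≤
      tensorSubspace K (fun r => symTensors K (n r) (U r))) (r : κ) (p p' : Fin (n r)) :
    a r p = a r p' := by
  classical
  choose v hne hspan using fun r p => exists_eq_span_singleton_of_finrank_eq_one (ha r p)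
  have hva : ∀ r p, v r p ∈ a r p := fun r p => hspan r p ▸ Submodule.mem_span_singleton_self _
  let T : ∀ r, ⨂[K]^(n r) (U r) := fun r => PiTensorProduct.tprod K (v r)
  have hT : PiTensorProduct.tprod K T ∈ tensorSubspace K (fun r => tensorSubspace K (a r)) := by
    refine ⟨PiTensorProduct.tprod K fun r =>
      ⟨T r, PiTensorProduct.tprod K fun p => ⟨v r p, hva r p⟩, PiTensorProduct.map_tprod _ _⟩, ?_⟩
    exact PiTensorProduct.map_tprod _ _
  have key : ∀ p p', a r p ≤ a r p' := by
    intro p p'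
    let σ := Equiv.swap p p'
    let τ : (⨂[K]^(n r) (U r)) →ₗ[K] ⨂[K]^(n r) (U r) :=
      (PiTensorProduct.reindex K (fun _ : Fin (n r) => U r) σ).toLinearMap
    have hτT : τ (T r) = PiTensorProduct.tprod K fun q => v r (σ.symm q) :=
      PiTensorProduct.reindex_tprod σ (v r)
    have hfix := slotMap_eq_of_mem_tensorSubspace (E := fun r => ⨂[K]^(n r) (U r))
      (P := fun r => symTensors K (n r) (U r)) r (q := τ) (fun x hx => hx σ) (h hT)
    have hup : slotMap (E := fun r => ⨂[K]^(n r) (U r)) r τ (PiTensorProduct.tprod K T) =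
        PiTensorProduct.tprod K (update T r (τ (T r))) := by
      rw [slotMap_apply, PiTensorProduct.map_tprod]
      congr 1
      funext l
      rcases eq_or_ne l r with rfl | hl
      · simp
      · simp [hl]
    rw [hup] at hfix
    have hne' : ∀ l, update T r (τ (T r)) l ≠ 0 := by
      intro l
      rcases eq_or_ne l r with rfl | hl
      · rw [update_self, hτT]
        exact tprod_ne_zero fun q => hne _ _
      · rw [update_of_ne hl]
        exact tprod_ne_zero fun q => hne _ _
    have hr := mem_span_of_tprod_eq_smul hne' (c := (1 : K)) (y := T) (by rw [hfix, one_smul]) r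
    rw [update_self, hτT] at hr
    obtain ⟨c, hc⟩ := Submodule.mem_span_singleton.1 hr
    have := mem_span_of_tprod_eq_smul (fun q => hne r (σ.symm q)) hc.symm p'
    rw [Equiv.symm_swap, Equiv.swap_apply_right] at this
    rw [hspan r p, hspan r p']
    exact (Submodule.span_singleton_le_iff_mem _ _).2 this
  exact le_antisymm (key p p') (key p' p)

end Decomposable

end SegreVeronese

open SegreVeronese in
theorem proposition2p22 {K : Type*} [RCLike K] {k m : ℕ} (d : Fin k → ℕ)
    (W : Fin k → Type*) [∀ i, AddCommGroup (W i)] [∀ i, Module K (W i)]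
    (Γ : ∀ j : Fin k, Submodule K (⨂[K] i : {i : Fin k // i ≠ j}, GroupedTensors K d W i))
    (hΓ : IsStandard K d W m Γ) (j : Fin k) :
    Γ j ≤ tensorSubspace K (fun i : {i : Fin k // i ≠ j} =>
        symTensors K (d i) (Module.Dual K (W i))) ∧
    ∀ a : (r : {r : Fin k // r ≠ j}) → Fin (d r) → Submodule K (Module.Dual K (W r)),
      (∀ r p, Module.finrank K (a r p) = 1) →
      Γ j = tensorSubspace K (fun r : {r : Fin k // r ≠ j} => tensorSubspace K (a r)) →
      ∃ b : (r : {r : Fin k // r ≠ j}) → Submodule K (Module.Dual K (W r)),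
        (∀ r p, a r p = b r) ∧
        Γ j = tensorSubspace K (fun r : {r : Fin k // r ≠ j} =>
          tensorSubspace K (fun _ : Fin (d r) => b r)) := by
  refine ⟨hΓ.le_tensorSubspace j, fun a ha hΓa => ?_⟩
  have hab : ∀ r p, a r p = a r ⟨0, hΓ.one_le r⟩ := fun r p =>
    eq_of_tensorSubspace_le_symTensors (n := fun r : {r : Fin k // r ≠ j} => d r) a ha
      (hΓa ▸ hΓ.le_tensorSubspace j) r p _
  refine ⟨fun r => a r ⟨0, hΓ.one_le r⟩, hab, hΓa.trans ?_⟩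
  congr 1
  funext r
  congr 1
  funext p
  exact hab r p
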